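/- **Graphs.** A labeled graph $G$ is a finite directed graph without loops or parallel edges together with a labeling $\ell_G\colon V(G)\to\mathbb{Z}$ of its nodes. It is *standard* if all labels are non-negative and $\ell_G(a)\le\ell_G(b)$ for every edge $(a,b)$. It is *canonical* if it is standard, has no directed cycles, has only positive labels, and satisfies $\ell_G(a)<\ell_G(b)$ for every edge $(a,b)$. It is *transitive* if its edge relation is a transitive relation on the nodes, and *connected* if it is non-empty and any two nodes are joined by a path of edges, ignoring their directions. A node $v$ *has (locally) maximal label* if there is no edge $(v,w)$ with $\ell_G(w)>\ell_G(v)$. **Standard sets.** A subset $\Delta\subseteq\mathbb{N}^d$, $d\ge 1$, is a *standard set* if its complement $C=\mathbb{N}^d\setminus\Delta$ satisfies $C+\mathbb{N}^d=C$. Let $q\colon\mathbb{N}^d\to\mathbb{N}^{d-1}$ be the projection that forgets the last coordinate. For $a\ge 1$, let $\Delta^a\subseteq q(\Delta)$ be the set of all $\gamma\in q(\Delta)$ such that exactly $a$ elements of $\Delta$ project to $\gamma$. A subset of $\mathbb{N}^{d-1}$ is *connected* if any two of its points are joined by a finite sequence of points of the subset in which consecutive points differ by a standard basis vector $\pm e_i$;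 connected components are maximal non-empty connected subsets. For a finite standard set $\Delta$, the *canonicalized standard graph* $G'(\Delta)$ has as nodes the connected components of the sets $\Delta^a$, $a\ge 1$. The label of a component of $\Delta^a$ is $a$. There is an edge from a component $B$ to a component $B'\ne B$ if and only if there are $\gamma'\in B$, $\gamma\in B'$ and an index $i$ with $\gamma'=\gamma+e_i$. **Proposition.** Let $G$ be a canonical, connected and transitive labeled graph containing exactly one node of (locally) maximal label. Then there exist an integer $d\ge 1$ and a finite standard set $\Delta\subseteq\mathbb{N}^d$ whose canonicalized standard graph $G'(\Delta)$ is isomorphic to $G$, by an isomorphism of directed graphs that preserves labels. -/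

import Mathlib

/-- A labeled graph with node set `V`: a directed graph without parallel edges and without loops,
together with an integer label on each node.  (`G.Adj a b` says that `(a, b)` is an edge.) -/
structure LabeledGraph (V : Type*) extends Digraph V where
  loopless : ∀ v, ¬ Adj v v
  label : V → ℤ

namespace LabeledGraph

variable {V W : Type*}

/-- All labels are non-negative and labels do not decrease along edges. -/
def IsStandard (G : LabeledGraph V) : Prop :=
  (∀ v, 0 ≤ G.label v) ∧ ∀ a b, G.Adj a b → G.label a ≤ G.label b

/-- There is no directed cycle. -/
def IsAcyclic (G : LabeledGraph V) : Prop :=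
  ∀ v, ¬ Relation.TransGen G.Adj v v

/-- Standard, without cycles, with positive labels that strictly increase along edges. -/
structure IsCanonical (G : LabeledGraph V) : Prop where
  standard : G.IsStandard
  acyclic : G.IsAcyclic
  label_pos : ∀ v, 0 < G.label v
  label_lt : ∀ a b, G.Adj a b → G.label a < G.label b

/-- The graph is non-empty, and any two nodes are joined by a sequence of edges, each of which
may be traversed in either direction. -/
def IsConnected (G : LabeledGraph V) : Prop :=
  Nonempty V ∧ ∀ a b, Relation.EqvGen G.Adj a b

/-- The edge relation is transitive. -/
def IsTransitive (G : LabeledGraph V) : Prop :=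
  ∀ a b c, G.Adj a b → G.Adj b c → G.Adj a c

/-- The node `v` has (locally) maximal label: no edge leads from `v` to a node of larger label. -/
def HasMaximalLabel (G : LabeledGraph V) (v : V) : Prop :=
  ∀ w, G.Adj v w → G.label w ≤ G.label v

/-- Two labeled graphs are the same up to renaming the nodes. -/
def IsIsomorphic (G : LabeledGraph V) (H : LabeledGraph W) : Prop :=
  ∃ φ : V ≃ W, (∀ a b, G.Adj a b ↔ H.Adj (φ a) (φ b)) ∧ ∀ a, G.label a = H.label (φ a)

end LabeledGraph

namespace StandardSet

open scoped Pointwise in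
/-- A subset `Δ` of `ℕ^d` is a standard set if its complement `C` satisfies `C + ℕ^d = C`. -/
def IsStandardSet {d : ℕ} (Δ : Set (Fin d → ℕ)) : Prop :=
  Δᶜ + Set.univ = Δᶜ

variable {n : ℕ}

/-- The height of `Δ ⊆ ℕ^(n+1)` over `γ ∈ ℕ^n`: the cardinality of the fiber over `γ` of the
projection `Δ → ℕ^n` that forgets the last coordinate. -/
noncomputable def height (Δ : Set (Fin (n + 1) → ℕ)) (γ : Fin n → ℕ) : ℕ :=
  {β ∈ Δ | Fin.init β = γ}.ncard

/-- The `a`-th isohypse of `Δ`: all points of height `a` in the projection of `Δ`. -/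
def isohypse (Δ : Set (Fin (n + 1) → ℕ)) (a : ℕ) : Set (Fin n → ℕ) :=
  {γ ∈ Fin.init '' Δ | height Δ γ = a}

/-- `γ' = γ + e_i` for some standard basis vector `e_i` of `ℕ^n`. -/
def IsUnitStep (γ' γ : Fin n → ℕ) : Prop :=
  ∃ i : Fin n, γ' = γ + Pi.single i 1

/-- `B` is connected: any two of its points are joined by a sequence of points of `B` in which
consecutive points differ by a standard basis vector. -/
def IsGridConnected (B : Set (Fin n → ℕ)) : Prop :=
  ∀ γ ∈ B, ∀ γ' ∈ B, Relation.ReflTransGen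
    (fun x y => x ∈ B ∧ y ∈ B ∧ (IsUnitStep y x ∨ IsUnitStep x y)) γ γ'

/-- `B` is a connected component of `A`: a non-empty connected subset of `A` that is maximal with
respect to inclusion. -/
def IsGridComponent (A B : Set (Fin n → ℕ)) : Prop :=
  B.Nonempty ∧ Maximal (fun S : Set (Fin n → ℕ) => S ⊆ A ∧ IsGridConnected S) B

/-- The nodes of the canonicalized standard graph: the connected components `B` of the isohypses
of `Δ` of height `a ≥ 1`, each recorded with its height as a pair `(a, B)`.  There is no need to
bound `a` above, since isohypses above the maximal height are empty and have no components. -/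
def CanonicalNode (Δ : Set (Fin (n + 1) → ℕ)) : Type :=
  {p : ℕ × Set (Fin n → ℕ) // 1 ≤ p.1 ∧ IsGridComponent (isohypse Δ p.1) p.2}

/-- The canonicalized standard graph of `Δ`.  There is an edge from a component `B` to a different
component `B'` if `γ' = γ + e_i` for some `γ' ∈ B`, some `γ ∈ B'` and some `i`. -/
def canonicalizedGraph (Δ : Set (Fin (n + 1) → ℕ)) : LabeledGraph (CanonicalNode Δ) where
  Adj P Q := P ≠ Q ∧ ∃ γ' ∈ P.1.2, ∃ γ ∈ Q.1.2, IsUnitStep γ' γ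
  loopless _ h := h.1 rfl
  label P := (P.1.1 : ℤ)

end StandardSet

/-! The edges form a finite strict order with a top node `t`. Give each node a coordinate, so that a
0/1 vector encodes a set of nodes. Use only the vectors of chains; over each put a column whose
height is the label of the chain's least node, taking `t` for the empty chain. A subchain has a
higher or equal least node, hence a column at least as high, so the columns form a standard set.
Chains with the same least node `v` form a cell, connected through the singleton of `v`
(`reflTransGen_single`). Unit steps between different cells follow edges and change the label, so
the cells are exactly the components (`subset_cell`). An edge from `v` to `w` appears in the step
from the chain of both to that of `w` alone. -/

namespace LabeledGraph

variable {V : Type*} {n : ℕ}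

/-- In a finite transitive graph, every node other than the unique
node of maximal label has an edge to that node. -/
theorem adj_top [Finite V] {G : LabeledGraph V} (htrans : G.IsTransitive) {t : V} (ht : ∀ v, G.HasMaximalLabel v → v = t) (v : V) :
    v = t ∨ G.Adj v t := by
  -- By transitivity the successors of `m` also lie in this set, so `m` is locally maximal.
  obtain ⟨m, hm, hmax⟩ := Set.exists_max_image {w | v = w ∨ G.Adj v w} G.label
    (Set.toFinite _) ⟨v, Or.inl rfl⟩
  have hmt : m = t := ht m fun w hw => by
    refine hmax w (Or.inr ?_)
    rcases hm with rfl | hm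
    · exact hw
    · exact htrans _ _ _ hm hw
  exact hmt ▸ hm

/-! ### Chains and their least nodes -/

/-- The point `γ` is the indicator vector of a chain of nodes with least element `v`; the zero
vector represents `t`. -/
structure Represents (G : LabeledGraph V) (t : V) (e : V ≃ Fin n) (γ : Fin n → ℕ) (v : V) :
    Prop where
  le_one : ∀ u, γ (e u) ≤ 1
  chain : ∀ u w, γ (e u) ≠ 0 → γ (e w) ≠ 0 → u = w ∨ G.Adj u w ∨ G.Adj w u
  mem : v = t ∨ γ (e v) ≠ 0
  least : ∀ u, γ (e u) ≠ 0 → v = u ∨ G.Adj v u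

/-- The points representing the node `v`. -/
def cell (G : LabeledGraph V) (t : V) (e : V ≃ Fin n) (v : V) : Set (Fin n → ℕ) :=
  {γ | G.Represents t e γ v}

/-- The standard set whose height over a point representing `v` is the label of `v`. -/
def cellSet (G : LabeledGraph V) (t : V) (e : V ≃ Fin n) : Set (Fin (n + 1) → ℕ) :=
  {β | ∃ v, G.Represents t e (Fin.init β) v ∧ (β (Fin.last n) : ℤ) < G.label v}

variable {G : LabeledGraph V} {t : V} {e : V ≃ Fin n} {γ γ' : Fin n → ℕ} {v w : V}

theorem Represents.unique (hlt : ∀ a b, G.Adj a b → G.label a < G.label b)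
    (htop : ∀ v, v = t ∨ G.Adj v t) (hv : G.Represents t e γ v) (hw : G.Represents t e γ w) :
    v = w := by
  have key : ∀ a b, G.Represents t e γ a → G.Represents t e γ b → a = b ∨ G.Adj a b := by
    intro a b ha hb
    rcases hb.mem with rfl | h
    · exact htop a
    · exact ha.least b h
  rcases key v w hv hw with h | h
  · exact h
  rcases key w v hw hv with h' | h'
  · exact h'.symm
  exact absurd (hlt _ _ h) (hlt _ _ h').not_gt

/-- The least node of a subchain lies in the larger chain, hence weakly above `v`; the empty
subchain gives the top node `t`. -/
theorem Represents.of_le [Finite V] (hlt : ∀ a b, G.Adj a b → G.label a < G.label b)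
    (htop : ∀ v, v = t ∨ G.Adj v t) (hv : G.Represents t e γ v) (hle : γ' ≤ γ) :
    ∃ w, G.Represents t e γ' w ∧ (v = w ∨ G.Adj v w) := by
  have hne : ∀ u, γ' (e u) ≠ 0 → γ (e u) ≠ 0 := fun u hu => by
    have : γ' (e u) ≤ γ (e u) := hle (e u)
    omega
  have h1 : ∀ u, γ' (e u) ≤ 1 := fun u => (hle (e u)).trans (hv.le_one u)
  have hch : ∀ u w, γ' (e u) ≠ 0 → γ' (e w) ≠ 0 → u = w ∨ G.Adj u w ∨ G.Adj w u :=
    fun u w hu hw => hv.chain u w (hne u hu) (hne w hw)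
  rcases Set.eq_empty_or_nonempty {u | γ' (e u) ≠ 0} with hs | hs
  · exact ⟨t, ⟨h1, hch, Or.inl rfl, fun u hu => absurd hu (Set.eq_empty_iff_forall_notMem.1 hs u)⟩,
      htop v⟩
  · obtain ⟨m, hm, hmin⟩ := Set.exists_min_image _ G.label (Set.toFinite _) hs
    refine ⟨m, ⟨h1, hch, Or.inr hm, fun u hu => ?_⟩, hv.least m (hne m hm)⟩
    rcases hch m u hm hu with h | h | h
    · exact Or.inl h
    · exact Or.inr h
    · exact absurd (hlt _ _ h) (hmin u hu).not_gt

theorem Represents.eq_or_adj_of_isUnitStep [Finite V]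
    (hlt : ∀ a b, G.Adj a b → G.label a < G.label b) (htop : ∀ v, v = t ∨ G.Adj v t)
    (hv : G.Represents t e γ' v) (hw : G.Represents t e γ w)
    (hstep : StandardSet.IsUnitStep γ' γ) : v = w ∨ G.Adj v w := by
  obtain ⟨i, rfl⟩ := hstep
  obtain ⟨w', hw', h⟩ := hv.of_le hlt htop (γ' := γ) le_self_add
  exact hw.unique hlt htop hw' ▸ h

theorem represents_single (v : V) : G.Represents t e (Pi.single (e v) 1) v := by
  have key : ∀ u, (Pi.single (e v) 1 : Fin n → ℕ) (e u) ≠ 0 → u = v := fun u hu => by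
    by_contra h
    exact hu (Pi.single_eq_of_ne (fun h' => h (e.injective h')) 1)
  refine ⟨fun u => ?_, fun u w hu hw => Or.inl ((key u hu).trans (key w hw).symm), Or.inr (by simp),
    fun u hu => Or.inl (key u hu).symm⟩
  by_cases h : u = v
  · simp [h]
  · by_contra h'
    exact h (key u (by omega))

/-- Removing an element other than the least one from a chain does not change the node. -/
theorem Represents.sub_single (hv : G.Represents t e γ v) {u : V} (huv : u ≠ v) :
    G.Represents t e (γ - Pi.single (e u) 1) v := by
  have hle : ∀ x, (γ - Pi.single (e u) 1 : Fin n → ℕ) (e x) ≤ γ (e x) := fun x => Nat.sub_le _ _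
  have hne : ∀ x, (γ - Pi.single (e u) 1 : Fin n → ℕ) (e x) ≠ 0 → γ (e x) ≠ 0 := fun x hx => by
    have := hle x
    omega
  refine ⟨fun x => (hle x).trans (hv.le_one x), fun x y hx hy => hv.chain x y (hne x hx) (hne y hy),
    hv.mem.imp_right fun h => ?_, fun x hx => hv.least x (hne x hx)⟩
  rwa [Pi.sub_apply, Pi.single_eq_of_ne (fun h' => huv (e.injective h').symm), Nat.sub_zero]

theorem isUnitStep_sub_single {i : Fin n} (h : γ i ≠ 0) :
    StandardSet.IsUnitStep γ (γ - Pi.single i 1) := by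
  refine ⟨i, (tsub_add_cancel_of_le fun j => ?_).symm⟩
  by_cases hj : j = i
  · subst hj
    simpa using Nat.one_le_iff_ne_zero.2 h
  · simp [Pi.single_eq_of_ne hj]

/-- Nodes other than `v` can be deleted one at a time without leaving the cell. -/
theorem reflTransGen_single (hv : G.Represents t e γ v) :
    Relation.ReflTransGen (fun x y => x ∈ G.cell t e v ∧ y ∈ G.cell t e v ∧
      (StandardSet.IsUnitStep y x ∨ StandardSet.IsUnitStep x y)) γ (Pi.single (e v) 1) := by
  induction hs : ∑ i, γ i using Nat.strong_induction_on generalizing γ with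
  | _ s ih =>
    by_cases h : ∃ u, u ≠ v ∧ γ (e u) ≠ 0
    · obtain ⟨u, huv, hu⟩ := h
      have hstep := isUnitStep_sub_single hu
      refine .head ⟨hv, hv.sub_single huv, Or.inr hstep⟩ (ih _ ?_ (hv.sub_single huv) rfl)
      rw [← hs]
      refine Finset.sum_lt_sum (fun i _ => Nat.sub_le _ _) ⟨e u, Finset.mem_univ _, ?_⟩
      simp only [Pi.sub_apply, Pi.single_eq_same]
      omega
    · push Not at h
      have h0 : ∀ i, i ≠ e v → γ i = 0 := fun i hi => by
        have := h (e.symm i) fun h' => hi (by rw [← h', e.apply_symm_apply])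
        rwa [e.apply_symm_apply] at this
      have hγ : γ = Pi.single (e v) (γ (e v)) := by
        ext i
        by_cases hi : i = e v
        · subst hi
          simp
        · rw [Pi.single_eq_of_ne hi, h0 i hi]
      have h1 := hv.le_one v
      interval_cases hc : γ (e v)
      -- Here `γ = 0`, the empty chain, and a single step up reaches the singleton.
      · refine .single ⟨hv, represents_single v, Or.inl ⟨e v, ?_⟩⟩
        rw [hγ]
        simp
      · rw [hγ]

theorem isGridConnected_cell (v : V) : StandardSet.IsGridConnected (G.cell t e v) := by
  intro γ hγ γ' hγ'
  refine (reflTransGen_single hγ).trans ?_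
  rw [← Relation.reflTransGen_swap]
  exact Relation.ReflTransGen.mono (fun x y h => ⟨h.2.1, h.1, h.2.2.symm⟩) _ _
    (reflTransGen_single hγ')

/-! ### Cells as components of isohypses -/

theorem height_cellSet (hpos : ∀ v, 0 < G.label v)
    (hlt : ∀ a b, G.Adj a b → G.label a < G.label b) (htop : ∀ v, v = t ∨ G.Adj v t)
    (hv : G.Represents t e γ v) :
    (StandardSet.height (G.cellSet t e) γ : ℤ) = G.label v := by
  have hset : {β ∈ G.cellSet t e | Fin.init β = γ} =
      (fun k : ℕ => (Fin.snoc γ k : Fin (n + 1) → ℕ)) '' Set.Iio (G.label v).toNat := by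
    ext β
    constructor
    · rintro ⟨⟨w, hw, hβ⟩, rfl⟩
      obtain rfl := hv.unique hlt htop hw
      exact ⟨β (Fin.last n), by simp only [Set.mem_Iio]; omega, Fin.snoc_init_self β⟩
    · rintro ⟨k, hk, rfl⟩
      simp only [Set.mem_Iio] at hk
      refine ⟨⟨v, ?_, ?_⟩, Fin.init_snoc _ _⟩
      · simpa only [Fin.init_snoc] using hv
      · simp only [Fin.snoc_last]
        omega
  have hinj : Function.Injective (fun k : ℕ => (Fin.snoc γ k : Fin (n + 1) → ℕ)) := fun a b h => by
    simpa using congrFun h (Fin.last n)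
  rw [StandardSet.height, hset, Set.ncard_image_of_injective _ hinj, Set.ncard_eq_toFinset_card',
    Set.toFinset_Iio, Nat.card_Iio]
  have := hpos v
  omega

theorem mem_isohypse_cellSet (hpos : ∀ v, 0 < G.label v)
    (hlt : ∀ a b, G.Adj a b → G.label a < G.label b) (htop : ∀ v, v = t ∨ G.Adj v t) {a : ℕ} :
    γ ∈ StandardSet.isohypse (G.cellSet t e) a ↔ ∃ v, γ ∈ G.cell t e v ∧ G.label v = a := by
  constructor
  · rintro ⟨⟨β, ⟨v, hv, -⟩, rfl⟩, rfl⟩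
    exact ⟨v, hv, (height_cellSet hpos hlt htop hv).symm⟩
  · rintro ⟨v, hv, ha⟩
    refine ⟨⟨Fin.snoc γ 0, ⟨v, ?_, ?_⟩, Fin.init_snoc _ _⟩, ?_⟩
    · rw [Fin.init_snoc]
      exact hv
    · simpa using hpos v
    · exact_mod_cast (height_cellSet hpos hlt htop hv).trans ha

/-- A step into another cell would follow an edge and so strictly change the label, but the label is
constantly `a` on `B`. -/
theorem subset_cell [Finite V] (hpos : ∀ v, 0 < G.label v)
    (hlt : ∀ a b, G.Adj a b → G.label a < G.label b) (htop : ∀ v, v = t ∨ G.Adj v t) {a : ℕ}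
    {B : Set (Fin n → ℕ)} (hB : B ⊆ StandardSet.isohypse (G.cellSet t e) a)
    (hconn : StandardSet.IsGridConnected B) (hγ : γ ∈ B) (hv : γ ∈ G.cell t e v) :
    B ⊆ G.cell t e v := by
  have label_eq : ∀ x ∈ B, ∀ w, x ∈ G.cell t e w → G.label w = a := fun x hx w hw => by
    obtain ⟨u, hu, hua⟩ := (mem_isohypse_cellSet hpos hlt htop).1 (hB hx)
    rw [hw.unique hlt htop hu, hua]
  intro δ hδ
  induction hconn γ hγ δ hδ with
  | refl => exact hv
  | @tail x y _ hxy ih =>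
    obtain ⟨hx, hy, hstep⟩ := hxy
    have hxv := ih hx
    obtain ⟨w, hw, hwa⟩ := (mem_isohypse_cellSet hpos hlt htop).1 (hB hy)
    have hva := label_eq x hx v hxv
    have hwv : w = v := by
      rcases hstep with h | h
      · rcases hw.eq_or_adj_of_isUnitStep hlt htop hxv h with h | h
        · exact h
        · have := hlt _ _ h
          omega
      · rcases hxv.eq_or_adj_of_isUnitStep hlt htop hw h with h | h
        · exact h.symm
        · have := hlt _ _ h
          omega
    exact hwv ▸ hw

theorem isGridComponent_cell [Finite V] (hpos : ∀ v, 0 < G.label v)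
    (hlt : ∀ a b, G.Adj a b → G.label a < G.label b) (htop : ∀ v, v = t ∨ G.Adj v t) {a : ℕ}
    (ha : G.label v = a) :
    StandardSet.IsGridComponent (StandardSet.isohypse (G.cellSet t e) a) (G.cell t e v) :=
  ⟨⟨_, represents_single v⟩,
    ⟨fun _ hγ => (mem_isohypse_cellSet hpos hlt htop).2 ⟨v, hγ, ha⟩, isGridConnected_cell v⟩,
    fun _ hB hle => subset_cell hpos hlt htop hB.1 hB.2 (hle (represents_single v))
      (represents_single v)⟩

theorem exists_eq_cell [Finite V] (hpos : ∀ v, 0 < G.label v)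
    (hlt : ∀ a b, G.Adj a b → G.label a < G.label b) (htop : ∀ v, v = t ∨ G.Adj v t) {a : ℕ}
    {B : Set (Fin n → ℕ)}
    (hB : StandardSet.IsGridComponent (StandardSet.isohypse (G.cellSet t e) a) B) :
    ∃ v, G.label v = a ∧ G.cell t e v = B := by
  obtain ⟨⟨γ, hγ⟩, hmax⟩ := hB
  obtain ⟨v, hv, ha⟩ := (mem_isohypse_cellSet hpos hlt htop).1 (hmax.prop.1 hγ)
  have hsub := subset_cell hpos hlt htop hmax.prop.1 hmax.prop.2 hγ hv
  exact ⟨v, ha, (hmax.eq_of_subset (isGridComponent_cell hpos hlt htop ha).2.prop hsub).symm⟩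

/-! ### Standardness, finiteness and the isomorphism -/

theorem isStandardSet_cellSet [Finite V] (hlt : ∀ a b, G.Adj a b → G.label a < G.label b)
    (htop : ∀ v, v = t ∨ G.Adj v t) : StandardSet.IsStandardSet (G.cellSet t e) := by
  refine Set.Subset.antisymm ?_ fun x hx => ⟨x, hx, 0, trivial, add_zero x⟩
  rintro _ ⟨x, hx, y, -, rfl⟩ ⟨v, hv, hlast⟩
  obtain ⟨w, hw, h⟩ := hv.of_le hlt htop (γ' := Fin.init x) fun i => Nat.le_add_right _ _
  refine hx ⟨w, hw, ?_⟩
  have h1 : G.label v ≤ G.label w := by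
    rcases h with rfl | h
    · exact le_rfl
    · exact (hlt _ _ h).le
  simp only [Pi.add_apply] at hlast
  omega

theorem finite_cellSet [Finite V] : (G.cellSet t e).Finite := by
  obtain ⟨M, hM⟩ := (Set.finite_range G.label).bddAbove
  -- Chain coordinates are at most 1, and the last one is below the largest label.
  refine (Set.finite_Iic (Fin.snoc (fun _ => 1) M.toNat : Fin (n + 1) → ℕ)).subset ?_
  rintro β ⟨v, hv, hlast⟩ i
  refine Fin.lastCases ?_ (fun j => ?_) i
  · have hv' : G.label v ≤ M := hM ⟨v, rfl⟩
    have h : β (Fin.last n) ≤ M.toNat := by omega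
    rwa [Fin.snoc_last]
  · have := hv.le_one (e.symm j)
    rw [e.apply_symm_apply] at this
    rw [Fin.snoc_castSucc]
    exact this

/-- Adding `v` to the one-element chain of `w` gives a chain with least element `v`. -/
theorem represents_single_add (h : G.Adj v w) :
    G.Represents t e (Pi.single (e w) 1 + Pi.single (e v) 1) v := by
  have hvw : v ≠ w := by
    rintro rfl
    exact G.loopless _ h
  have hval : ∀ u, (Pi.single (e w) 1 + Pi.single (e v) 1 : Fin n → ℕ) (e u) ≠ 0 →
      u = v ∨ u = w := fun u hu => by
    by_contra! hne
    simp [hne.1, hne.2] at hu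
  refine ⟨fun u => ?_, fun x y hx hy => ?_, Or.inr (by simp), fun u hu => ?_⟩
  · by_cases hu : u = v
    · simp [hu, hvw]
    · by_cases hu' : u = w
      · simp [hu', hvw.symm]
      · simp [hu, hu']
  · rcases hval x hx with rfl | rfl <;> rcases hval y hy with rfl | rfl <;> simp [h]
  · rcases hval u hu with rfl | rfl <;> simp [h]

theorem isIsomorphic_canonicalizedGraph_cellSet [Finite V] (hpos : ∀ v, 0 < G.label v)
    (hlt : ∀ a b, G.Adj a b → G.label a < G.label b) (htop : ∀ v, v = t ∨ G.Adj v t) :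
    G.IsIsomorphic (StandardSet.canonicalizedGraph (G.cellSet t e)) := by
  have hcast : ∀ v, G.label v = ((G.label v).toNat : ℤ) := fun v =>
    (Int.toNat_of_nonneg (hpos v).le).symm
  let f : V → StandardSet.CanonicalNode (G.cellSet t e) := fun v =>
    ⟨((G.label v).toNat, G.cell t e v), by have := hpos v; simp only; omega,
      isGridComponent_cell hpos hlt htop (hcast v)⟩
  have hinj : Function.Injective f := fun v w h => by
    have hcell : G.cell t e v = G.cell t e w := congrArg (fun P => P.1.2) h
    have hv : Pi.single (e v) 1 ∈ G.cell t e v := represents_single v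
    have hw : Pi.single (e v) 1 ∈ G.cell t e w := hcell ▸ hv
    exact hv.unique hlt htop hw
  have hsurj : Function.Surjective f := by
    rintro ⟨⟨a, B⟩, ha, hB⟩
    obtain ⟨v, hv, hvB⟩ := exists_eq_cell hpos hlt htop hB
    refine ⟨v, Subtype.ext (Prod.ext ?_ hvB)⟩
    change (G.label v).toNat = a
    rw [hv, Int.toNat_natCast]
  refine ⟨Equiv.ofBijective f ⟨hinj, hsurj⟩, fun a b => ⟨fun h => ⟨fun hab => ?_, ?_⟩, ?_⟩, hcast⟩
  · exact G.loopless b (hinj hab ▸ h)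
  · exact ⟨_, represents_single_add h, _, represents_single b, e a, rfl⟩
  · rintro ⟨hne, γ', hγ', γ, hγ, hstep⟩
    refine (Represents.eq_or_adj_of_isUnitStep hlt htop hγ' hγ hstep).resolve_left ?_
    rintro rfl
    exact hne rfl

end LabeledGraph

theorem mainTheorem5 {V : Type*} [Finite V] (G : LabeledGraph V)
    (hcan : G.IsCanonical) (hconn : G.IsConnected) (htrans : G.IsTransitive)
    (hmax : ∃! v, G.HasMaximalLabel v) :
    ∃ (n : ℕ) (Δ : Set (Fin (n + 1) → ℕ)),
      Δ.Finite ∧ StandardSet.IsStandardSet Δ ∧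
        G.IsIsomorphic (StandardSet.canonicalizedGraph Δ) := by
  obtain ⟨t, -, ht⟩ := hmax
  have htop := LabeledGraph.adj_top htrans ht
  exact ⟨Nat.card V, G.cellSet t (Finite.equivFin V), LabeledGraph.finite_cellSet,
    LabeledGraph.isStandardSet_cellSet hcan.label_lt htop,
    LabeledGraph.isIsomorphic_canonicalizedGraph_cellSet hcan.label_pos hcan.label_lt htop⟩
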